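/- Let $\kappa$ be an uncountable cardinal and let $G_0$ be a countable (finite or countably infinite) group with $|G_0|\ge 3$. Let $G$ be a limit of regular representations of length $\kappa$ with base $G_0$; that is, $G$ is the direct limit of a directed system of groups $(G_\alpha)_{\alpha<\kappa}$, indexed by the ordinals $\alpha<\kappa$ and starting with $G_0$, such that - $G_{\alpha+1}=\mathrm{Sym}(G_\alpha)$ is the group of all permutations of the set $G_\alpha$, and the map $G_\alpha\hookrightarrow G_{\alpha+1}$ of the system is the right regular representation $g\mapsto(x\mapsto xg^{-1})$, for all $\alpha<\kappa$; - $G_\gamma=\varinjlim_{\alpha<\gamma}G_\alpha$ for all limit ordinals $\gamma<\kappa$. Then $$|\mathrm{Aut}(G)|=\beth_{\kappa+1},$$ where $\beth_0=\aleph_0$, $\beth_{\alpha+1}=2^{\beth_\alpha}$ for all ordinals $\alpha$, $\beth_\gamma=\sup_{\alpha<\gamma}\beth_\alpha$ for limit ordinals $\gamma$, and in the index $\kappa+1$ the cardinal $\kappa$ is read as its initial ordinal. -/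

import Mathlib

open Cardinal Ordinal

universe u v

/-- The right regular representation `H → Sym(H)`, sending `g` to `x ↦ x * g⁻¹`. The inverse makes
it a homomorphism, since the product of permutations is composition from right to left. -/
def rightRegular (H : Type u) [Group H] : H →* Equiv.Perm H where
  toFun g := Equiv.mulRight g⁻¹
  map_one' := by ext x; simp
  map_mul' g h := by ext x; simp [mul_assoc]

/-- The group `L` together with the homomorphisms `φ i : X i →* L` is the direct limit of the
directed system of groups `(X, f)`: the `φ i` are compatible with the `f i j`, and the canonical
map from the direct limit of the system to `L` which they induce is a bijection. -/
def IsGroupDirectLimit {ι : Type v} [LinearOrder ι] (X : ι → Type u) [∀ i, Group (X i)]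
    (f : ∀ i j : ι, i ≤ j → X i →* X j) [DirectedSystem X (f · · ·)]
    {L : Type u} [Group L] (φ : ∀ i, X i →* L) : Prop :=
  ∃ compat : ∀ (i j : ι) (h : i ≤ j) (x : X i), φ i x = φ j (f i j h x),
    Function.Bijective (DirectLimit.lift f (fun i x => φ i x) compat)

/-- A presentation of the group `G` as the limit of regular representations of length `κ` with
base `G₀`. The stages are indexed by the ordinals below (the initial ordinal of) `κ`. -/
structure LimitOfRegularRepresentations (κ : Cardinal.{u}) (G₀ G : Type u) [Group G₀] [Group G]
    where
  /-- the groups `G_α` for `α < κ` -/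
  X : Set.Iio κ.ord → Type u
  [group : ∀ α, Group (X α)]
  /-- the homomorphisms `G_α → G_β` for `α ≤ β < κ` -/
  f : ∀ α β : Set.Iio κ.ord, α ≤ β → X α →* X β
  [directedSystem : DirectedSystem X (f · · ·)]
  /-- the group at stage `0` is the base -/
  baseIso : ∀ α : Set.Iio κ.ord, (α : Ordinal.{u}) = 0 → (X α ≃* G₀)
  /-- `G_{α+1} = Sym(G_α)` -/
  succIso : ∀ α β : Set.Iio κ.ord, (β : Ordinal.{u}) = (α : Ordinal.{u}) + 1 →
    (X β ≃* Equiv.Perm (X α))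
  /-- `G_α` embeds into `G_{α+1} = Sym(G_α)` by its right regular representation -/
  succIso_map : ∀ (α β : Set.Iio κ.ord) (h : (β : Ordinal.{u}) = (α : Ordinal.{u}) + 1)
    (hle : α ≤ β) (x : X α), succIso α β h (f α β hle x) = rightRegular (X α) x
  /-- `G_γ` is the direct limit of the `G_α` with `α < γ`, for `γ` limit -/
  limit : ∀ γ : Set.Iio κ.ord, Order.IsSuccLimit (γ : Ordinal.{u}) →
    haveI : DirectedSystem (fun α : Set.Iio γ => X α)
        (fun α β h => f α.1 β.1 h) :=
      ⟨fun _ x => directedSystem.map_self x, fun _ _ _ h h' x => directedSystem.map_map h h' x⟩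
    IsGroupDirectLimit (fun α : Set.Iio γ => X α)
      (fun α β h => f α.1 β.1 h) (fun α => f α.1 γ (le_of_lt α.2))
  /-- the homomorphisms `G_α → G` -/
  ι : ∀ α, X α →* G
  /-- `G` is the direct limit of the `G_α` with `α < κ` -/
  isLimit : IsGroupDirectLimit X f ι

/-! Counting gives `#G = ℶ_ κ.ord`, so only `2 ^ #G ≤ #(MulAut G)` needs an idea. Left
multiplications of `H` commute with its right regular image, so an automorphism `φ` of `H` extends
to `Sym(H)` as conjugation by `φ ∘ (h * ·)` for every `h : H`. Distinct `h` give distinct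
extensions, because `Sym(H)` has trivial centre when `3 ≤ #H`. Choosing `h α` freely at every stage
and passing to limits embeds `∀ α, S.X α` into `MulAut G`.

This product is large enough: `G` is covered by the infinite stages `ω + α`, so a subset of `G` is
coded by a family of subsets of these stages, and the power set of stage `ω + α` has the size of
stage `ω + α + 1`. -/

theorem Equiv.Perm.eq_one_of_forall_commute {X : Type u} (hX : 3 ≤ #X) {σ : Equiv.Perm X}
    (h : ∀ τ : Equiv.Perm X, σ * τ = τ * σ) : σ = 1 := by
  classical
  by_contra hσ
  obtain ⟨x, hx⟩ : ∃ x, σ x ≠ x := by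
    by_contra! hx
    exact hσ (Equiv.ext hx)
  obtain ⟨z, hz, hz'⟩ : ∃ z, z ≠ x ∧ z ≠ σ x := by
    by_contra! hz
    have hcard : #X ≤ #({x, σ x} : Set X) := by
      rw [← mk_univ]
      refine mk_le_mk_of_subset fun z _ => ?_
      by_cases hzx : z = x
      · exact Or.inl hzx
      · exact Or.inr (hz z hzx)
    have h2 : #({x, σ x} : Set X) ≤ 2 := by
      refine (mk_insert_le).trans ?_
      rw [mk_singleton]
      norm_num
    have := hX.trans (hcard.trans h2)
    norm_num at this
  -- This transposition fixes `x` but moves `σ x` to `z`, so commuting with it would force `σ x =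
  -- z`.
  have hc := congrArg (fun τ : Equiv.Perm X => τ x) (h (Equiv.swap (σ x) z))
  simp only [Equiv.Perm.mul_apply, Equiv.swap_apply_left] at hc
  rw [Equiv.swap_apply_of_ne_of_ne (Ne.symm hx) (Ne.symm hz)] at hc
  exact hz' hc.symm

theorem Cardinal.lt_mk_perm {X : Type u} (hX : 3 ≤ #X) : #X < #(Equiv.Perm X) := by
  classical
  rcases finite_or_infinite X with _ | _
  · have := Fintype.ofFinite X
    rw [mk_fintype] at hX
    rw [mk_fintype, mk_fintype, Fintype.card_perm]
    exact_mod_cast Nat.lt_factorial_self (by exact_mod_cast hX)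
  · rw [mk_perm_eq_two_power]
    exact cantor _

theorem Cardinal.mk_perm_le_two_power {X : Type u} {c : Cardinal.{u}} (hc : ℵ₀ ≤ c)
    (hX : #X ≤ c) : #(Equiv.Perm X) ≤ 2 ^ c := by
  have h1 : #(Equiv.Perm X) ≤ #(X → X) :=
    mk_le_of_injective (f := fun σ : Equiv.Perm X => (σ : X → X)) DFunLike.coe_injective
  refine h1.trans ?_
  rw [← power_def, ← power_self_eq hc]
  exact (power_le_power_right hX).trans (power_le_power_left (aleph0_pos.trans_le hc).ne' hX)

theorem Cardinal.mk_mulAut_le_two_power {G : Type u} [Group G] [Infinite G] :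
    #(MulAut G) ≤ 2 ^ #G := by
  rw [← mk_perm_eq_two_power]
  exact mk_le_of_injective (f := fun σ : MulAut G => σ.toEquiv) MulEquiv.toEquiv_injective

/-! ### Extending automorphisms along the right regular representation -/

theorem rightRegular_injective (H : Type u) [Group H] : Function.Injective (rightRegular H) := by
  intro g h hgh
  have := congrArg (fun σ : Equiv.Perm H => σ 1) hgh
  simpa [rightRegular] using this

/-- Conjugation by `φ ∘ (h * ·)` extends the automorphism `φ` of `H` to `Sym(H)`. -/
theorem conj_mul_mulLeft_rightRegular {H : Type u} [Group H] (φ : MulAut H) (h g : H) :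
    MulAut.conj (φ.toEquiv * Equiv.mulLeft h : Equiv.Perm H) (rightRegular H g) =
      rightRegular H (φ g) := by
  rw [MulAut.conj_apply, mul_inv_eq_iff_eq_mul]
  ext x
  simp [rightRegular, mul_assoc]

/-- Two choices with equal conjugations differ by a central permutation, which is trivial;
evaluating at `1` recovers `h`. -/
theorem conj_mul_mulLeft_injective {H : Type u} [Group H] (hH : 3 ≤ #H) (φ : MulAut H) :
    Function.Injective fun h : H =>
      MulAut.conj (φ.toEquiv * Equiv.mulLeft h : Equiv.Perm H) := by
  intro h h' hh
  simp only [map_mul] at hh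
  have hh := mul_left_cancel hh
  have hone : (Equiv.mulLeft h' : Equiv.Perm H)⁻¹ * Equiv.mulLeft h = 1 := by
    refine Equiv.Perm.eq_one_of_forall_commute hH fun τ => ?_
    have := DFunLike.congr_fun hh τ
    rw [MulAut.conj_apply, MulAut.conj_apply, mul_inv_eq_iff_eq_mul] at this
    rw [mul_assoc, this]
    group
  have := congrArg (fun σ : Equiv.Perm H => σ 1) (inv_mul_eq_one.1 hone)
  simpa using this.symm

theorem Pi.surjective_comp_injective {I J : Type*} {X : J → Type*} [∀ j, Nonempty (X j)]
    {g : I → J} (hg : Function.Injective g) :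
    Function.Surjective fun (x : ∀ j, X j) (i : I) => x (g i) := by
  classical
  intro y
  refine ⟨fun j => if h : ∃ i, g i = j then h.choose_spec ▸ y h.choose
    else Classical.arbitrary _, ?_⟩
  funext i
  have h : ∃ i', g i' = g i := ⟨i, rfl⟩
  simp only [dif_pos h]
  have key : ∀ (i' : I) (e : g i' = g i), (e ▸ y i' : X (g i)) = y i := by
    intro i' e
    obtain rfl := hg e
    rfl
  exact key _ _

/-! ### Direct limits with injective transition maps -/

namespace IsGroupDirectLimit

variable {ι : Type v} [LinearOrder ι] {X : ι → Type u} [∀ i, Group (X i)]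
  {f : ∀ i j : ι, i ≤ j → X i →* X j} [DirectedSystem X (f · · ·)]
  {L : Type u} [Group L] {φ : ∀ i, X i →* L}

theorem map_eq (h : IsGroupDirectLimit X f φ) {i j : ι} (hij : i ≤ j) (x : X i) :
    φ j (f i j hij x) = φ i x :=
  (h.1 i j hij x).symm

theorem exists_rep (h : IsGroupDirectLimit X f φ) (y : L) : ∃ i x, φ i x = y := by
  obtain ⟨compat, -, hs⟩ := h
  obtain ⟨z, rfl⟩ := hs y
  obtain ⟨i, x, rfl⟩ := DirectLimit.exists_eq_mk f z
  exact ⟨i, x, rfl⟩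

theorem injective (h : IsGroupDirectLimit X f φ)
    (hf : ∀ i j hij, Function.Injective (f i j hij)) (i : ι) : Function.Injective (φ i) := by
  obtain ⟨compat, hi, -⟩ := h
  intro x y hxy
  exact DirectLimit.mk_injective f hf i (hi hxy)

theorem exists_hom (h : IsGroupDirectLimit X f φ) (hf : ∀ i j hij, Function.Injective (f i j hij))
    (a : ∀ i, X i →* X i) (ha : ∀ i j hij x, a j (f i j hij x) = f i j hij (a i x)) :
    ∃ b : L → L, (∀ i x, b (φ i x) = φ i (a i x)) ∧ ∀ y z, b (y * z) = b y * b z := by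
  choose r s hrs using h.exists_rep
  -- Independence of the representative: both are moved to stage `max i j`, where they coincide by
  -- injectivity.
  have hwd : ∀ i j x y, φ i x = φ j y → φ i (a i x) = φ j (a j y) := by
    intro i j x y hxy
    rw [← h.map_eq (le_max_left i j), ← h.map_eq (le_max_right i j), ← ha, ← ha]
    congr 2
    apply h.injective hf
    rw [h.map_eq, h.map_eq, hxy]
  have key : ∀ i x, φ (r (φ i x)) (a _ (s (φ i x))) = φ i (a i x) :=
    fun i x => hwd _ _ _ _ (hrs _)
  refine ⟨fun y => φ (r y) (a _ (s y)), key, fun y z => ?_⟩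
  obtain ⟨i, x, rfl⟩ := h.exists_rep y
  obtain ⟨j, x', rfl⟩ := h.exists_rep z
  rw [← h.map_eq (le_max_left i j), ← h.map_eq (le_max_right i j), ← map_mul]
  simp only [key, map_mul]

/-- A compatible family of automorphisms of the stages has a limit automorphism. -/
theorem exists_mulAut (h : IsGroupDirectLimit X f φ)
    (hf : ∀ i j hij, Function.Injective (f i j hij))
    (a : ∀ i, MulAut (X i)) (ha : ∀ i j hij x, a j (f i j hij x) = f i j hij (a i x)) :
    ∃ b : MulAut L, ∀ i x, b (φ i x) = φ i (a i x) := by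
  obtain ⟨b, hb, hbm⟩ := h.exists_hom hf (fun i => (a i).toMonoidHom) ha
  obtain ⟨c, hc, -⟩ := h.exists_hom hf (fun i => (a i)⁻¹.toMonoidHom) (by
    intro i j hij x
    apply (a j).injective
    simp [ha])
  refine ⟨⟨⟨b, c, fun y => ?_, fun y => ?_⟩, hbm⟩, hb⟩
  · obtain ⟨i, x, rfl⟩ := h.exists_rep y
    simp [hb, hc]
  · obtain ⟨i, x, rfl⟩ := h.exists_rep y
    simp [hb, hc]

theorem mk_le (h : IsGroupDirectLimit X f φ) {c : Cardinal.{u}} (hc : ℵ₀ ≤ c)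
    (hι : lift.{u} #ι ≤ lift.{v} c) (hX : ∀ i, #(X i) ≤ c) : #L ≤ c := by
  have hs : Function.Surjective fun p : Σ i, X i => φ p.1 p.2 := by
    intro y
    obtain ⟨i, x, hx⟩ := h.exists_rep y
    exact ⟨⟨i, x⟩, hx⟩
  have h1 := lift_mk_le'.2 ⟨Function.Embedding.ofSurjective _ hs⟩
  have h2 : #(Σ i, X i) ≤ lift.{v} c := by
    rw [mk_sigma]
    refine (sum_le_sum _ (fun _ => c) hX).trans ?_
    rw [sum_const]
    refine (mul_le_mul' hι le_rfl).trans ?_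
    rw [mul_eq_self (by simpa using hc)]
  rw [← Cardinal.lift_le.{max u v}]
  refine h1.trans ((Cardinal.lift_le.2 h2).trans_eq ?_)
  rw [Cardinal.lift_lift]

end IsGroupDirectLimit

/-! ### Basic structure of the tower of groups -/

namespace LimitOfRegularRepresentations

attribute [instance] LimitOfRegularRepresentations.group
  LimitOfRegularRepresentations.directedSystem

variable {κ : Cardinal.{u}} {G₀ G : Type u} [Group G₀] [Group G]
  (S : LimitOfRegularRepresentations κ G₀ G)

instance directedSystem_Iio (γ : Set.Iio κ.ord) :
    DirectedSystem (fun α : Set.Iio γ => S.X α) (fun α β h => S.f α.1 β.1 h) :=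
  ⟨fun _ x => S.directedSystem.map_self x, fun _ _ _ h h' x => S.directedSystem.map_map h h' x⟩

theorem f_self (α : Set.Iio κ.ord) (h : α ≤ α) (x : S.X α) : S.f α α h x = x :=
  S.directedSystem.map_self x

theorem f_f {α β γ : Set.Iio κ.ord} (h : α ≤ β) (h' : β ≤ γ) (x : S.X α) :
    S.f β γ h' (S.f α β h x) = S.f α γ (h.trans h') x :=
  S.directedSystem.map_map h h' x

theorem succ_or_limit (γ : Set.Iio κ.ord) : (γ : Ordinal.{u}) = 0 ∨
    (∃ α : Set.Iio κ.ord, (γ : Ordinal.{u}) = (α : Ordinal.{u}) + 1) ∨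
    Order.IsSuccLimit (γ : Ordinal.{u}) := by
  rcases zero_or_succ_or_isSuccLimit (γ : Ordinal.{u}) with h | ⟨o, ho⟩ | h
  · exact Or.inl h
  · refine Or.inr (Or.inl ⟨⟨o, ?_⟩, ?_⟩)
    · exact lt_of_lt_of_le ((Order.lt_succ o).trans_eq ho) γ.2.le
    · exact ho.symm
  · exact Or.inr (Or.inr h)

theorem le_of_lt_of_eq_add_one {α β γ : Set.Iio κ.ord} (hγ : (γ : Ordinal.{u}) = β + 1)
    (h : α < γ) : α ≤ β := by
  have h : (α : Ordinal.{u}) < γ := h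
  rw [hγ] at h
  exact (Order.lt_add_one_iff (x := (α : Ordinal.{u}))).1 h

theorem f_succ_injective {α β : Set.Iio κ.ord} (h : (β : Ordinal.{u}) = α + 1) (hle : α ≤ β) :
    Function.Injective (S.f α β hle) := by
  intro x y hxy
  have := congrArg (S.succIso α β h) hxy
  rw [S.succIso_map, S.succIso_map] at this
  exact rightRegular_injective _ this

theorem f_injective (α β : Set.Iio κ.ord) (hle : α ≤ β) : Function.Injective (S.f α β hle) := by
  induction β using WellFoundedLT.induction generalizing α with
  | ind β ih =>
  rcases hle.eq_or_lt with rfl | hlt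
  · intro x y hxy
    rwa [f_self, f_self] at hxy
  rcases succ_or_limit β with h | ⟨γ, h⟩ | h
  · exact absurd (show (α : Ordinal.{u}) < β from hlt) (by simp [h])
  · have hγβ : γ < β := show (γ : Ordinal.{u}) < β by rw [h]; exact Order.lt_add_one_iff.2 le_rfl
    have hαγ := le_of_lt_of_eq_add_one h hlt
    intro x y hxy
    rw [← S.f_f hαγ hγβ.le, ← S.f_f hαγ hγβ.le] at hxy
    exact ih γ hγβ α hαγ (S.f_succ_injective h _ hxy)
  · exact (S.limit β h).injective (fun i j hij => ih j.1 j.2 i.1 hij) ⟨α, hlt⟩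

theorem ι_injective (α : Set.Iio κ.ord) : Function.Injective (S.ι α) :=
  S.isLimit.injective S.f_injective α

theorem mk_mono {α β : Set.Iio κ.ord} (h : α ≤ β) : #(S.X α) ≤ #(S.X β) :=
  mk_le_of_injective (S.f_injective α β h)

theorem mk_succ {α β : Set.Iio κ.ord} (h : (β : Ordinal.{u}) = α + 1) :
    #(S.X β) = #(Equiv.Perm (S.X α)) :=
  mk_congr (S.succIso α β h).toEquiv

theorem three_le_mk (h0 : 3 ≤ #G₀) (α : Set.Iio κ.ord) : 3 ≤ #(S.X α) := by
  let z : Set.Iio κ.ord := ⟨0, lt_of_le_of_lt zero_le (Set.mem_Iio.1 α.2)⟩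
  have hz : #(S.X z) = #G₀ := mk_congr (S.baseIso z rfl).toEquiv
  exact (h0.trans_eq hz.symm).trans (S.mk_mono (show (0 : Ordinal.{u}) ≤ α from zero_le))

/-! ### Cardinalities of the stages -/

theorem mk_le_beth [Countable G₀] (α : Set.Iio κ.ord) : #(S.X α) ≤ ℶ_ (α : Ordinal.{u}) := by
  induction α using WellFoundedLT.induction with
  | ind α ih =>
  rcases succ_or_limit α with h | ⟨β, h⟩ | h
  · rw [h, beth_zero, mk_congr (S.baseIso α h).toEquiv]
    exact mk_le_aleph0
  · rw [S.mk_succ h, h, beth_add_one]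
    refine mk_perm_le_two_power (aleph0_le_beth _) (ih β ?_)
    exact show (β : Ordinal.{u}) < α by rw [h]; exact Order.lt_add_one_iff.2 le_rfl
  · refine (S.limit α h).mk_le (aleph0_le_beth _) ?_ fun β => ?_
    · have hinj : Function.Injective
          fun β : Set.Iio α => (⟨β.1.1, β.2⟩ : Set.Iio (α : Ordinal.{u})) := by
        intro β γ hβγ
        exact Subtype.ext (Subtype.ext (congrArg (fun x => x.1) hβγ))
      have := mk_le_of_injective hinj
      rw [Cardinal.mk_Iio_ordinal] at this
      rw [Cardinal.lift_id'.{u, u + 1}]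
      exact this.trans (Cardinal.lift_le.2 (Ordinal.card_le_beth _))
    · exact (ih β.1 β.2).trans (beth_le_beth.2 (le_of_lt β.2))

theorem natCast_le_mk (h0 : 3 ≤ #G₀) (n : ℕ) (hn : (n : Ordinal.{u}) < κ.ord) :
    (n : Cardinal.{u}) ≤ #(S.X ⟨n, hn⟩) := by
  induction n with
  | zero => simp
  | succ n ih =>
    have hlt : (n : Ordinal.{u}) < κ.ord := lt_trans (by exact_mod_cast n.lt_succ_self) hn
    rw [S.mk_succ (α := ⟨n, hlt⟩) (by simp)]
    have := (ih hlt).trans_lt (lt_mk_perm (S.three_le_mk h0 ⟨n, hlt⟩))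
    rw [Nat.cast_succ]
    exact Cardinal.add_one_le_of_lt this

/-- The shift by `ω` allows for a finite base: the finite stages grow strictly, so stage `ω` is
infinite, and from there each successor is a power set in size. -/
theorem beth_le_mk (h0 : 3 ≤ #G₀) (hκ : ℵ₀ < κ) (o : Ordinal.{u}) (ho : ω + o < κ.ord) :
    ℶ_ o ≤ #(S.X ⟨ω + o, ho⟩) := by
  have hω : ω < κ.ord := omega0_lt_ord.2 hκ
  have haleph : ∀ β : Set.Iio κ.ord, ω ≤ (β : Ordinal.{u}) → ℵ₀ ≤ #(S.X β) := by
    intro β hβ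
    refine aleph0_le.2 fun n => ?_
    have hn : (n : Ordinal.{u}) < ω := natCast_lt_omega0 n
    exact (S.natCast_le_mk h0 n (hn.trans hω)).trans
      (S.mk_mono (show (n : Ordinal.{u}) ≤ β from hn.le.trans hβ))
  induction o using WellFoundedLT.induction with
  | ind o ih =>
  rcases zero_or_succ_or_isSuccLimit o with rfl | ⟨p, rfl⟩ | h
  · rw [beth_zero]
    exact haleph _ (by simp)
  · have hlt : ω + p < ω + Order.succ p := by simp
    have hp := hlt.trans ho
    rw [S.mk_succ (α := ⟨ω + p, hp⟩) (by simp [Order.succ_eq_add_one, add_assoc]), beth_succ]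
    have : Infinite (S.X ⟨ω + p, hp⟩) := infinite_iff.2 (haleph _ (by simp))
    rw [mk_perm_eq_two_power]
    exact power_le_power_left two_ne_zero (ih p (Order.lt_succ p) hp)
  · rw [beth_limit h]
    refine ciSup_le' fun p => ?_
    have hlt : ω + (p : Ordinal.{u}) < ω + o := (add_lt_add_iff_left ω).2 p.2
    exact (ih p p.2 (hlt.trans ho)).trans (S.mk_mono (show ω + (p : Ordinal.{u}) ≤ ω + o from hlt.le))

theorem mk_eq_beth (S : LimitOfRegularRepresentations κ G₀ G) [Countable G₀]
    (h0 : 3 ≤ #G₀) (hκ : ℵ₀ < κ) : #G = ℶ_ κ.ord := by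
  apply le_antisymm
  · refine S.isLimit.mk_le (aleph0_le_beth _) ?_ fun β => ?_
    · rw [Cardinal.mk_Iio_ordinal, Cardinal.lift_id'.{u, u + 1}]
      exact Cardinal.lift_le.2 (Ordinal.card_le_beth _)
    · exact (S.mk_le_beth β).trans (beth_le_beth.2 (le_of_lt β.2))
  · rw [beth_limit (isSuccLimit_ord hκ.le)]
    refine ciSup_le' fun p => ?_
    have hp : ω + (p : Ordinal.{u}) < κ.ord :=
      isPrincipal_add_ord hκ.le (omega0_lt_ord.2 hκ) p.2
    exact (S.beth_le_mk h0 hκ p hp).trans (mk_le_of_injective (S.ι_injective _))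

/-! ### Automorphisms -/

/-- `IsExtension h α φ ψ`: the automorphism `ψ` of the `α`-th stage extends the automorphisms `φ β`
of the previous stages, and if `α = β + 1`, then it is conjugation by `φ β ∘ (h β * ·)`. -/
def IsExtension (h : ∀ α, S.X α) (α : Set.Iio κ.ord)
    (φ : ∀ β : Set.Iio κ.ord, β < α → MulAut (S.X β)) (ψ : MulAut (S.X α)) : Prop :=
  (∀ (β : Set.Iio κ.ord) (hβ : β < α) (x : S.X β),
    ψ (S.f β α hβ.le x) = S.f β α hβ.le (φ β hβ x)) ∧
  ∀ (β : Set.Iio κ.ord) (hβ : β < α) (e : (α : Ordinal.{u}) = β + 1) (y : S.X α),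
    S.succIso β α e (ψ y) =
      MulAut.conj ((φ β hβ).toEquiv * Equiv.mulLeft (h β) : Equiv.Perm (S.X β)) (S.succIso β α e y)

theorem exists_isExtension (h : ∀ α, S.X α) (α : Set.Iio κ.ord)
    (φ : ∀ β : Set.Iio κ.ord, β < α → MulAut (S.X β))
    (hφ : ∀ (β γ : Set.Iio κ.ord) (hγ : γ < α) (hβγ : β ≤ γ) (x : S.X β),
      φ γ hγ (S.f β γ hβγ x) = S.f β γ hβγ (φ β (hβγ.trans_lt hγ) x)) :
    ∃ ψ, S.IsExtension h α φ ψ := by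
  rcases succ_or_limit α with hα | ⟨γ, hα⟩ | hα
  · have hnot : ∀ β : Set.Iio κ.ord, ¬ β < α := fun β hβ =>
      absurd (show (β : Ordinal.{u}) < α from hβ) (by simp [hα])
    exact ⟨1, fun β hβ => absurd hβ (hnot β), fun β hβ => absurd hβ (hnot β)⟩
  · have hγα : γ < α := show (γ : Ordinal.{u}) < α by rw [hα]; exact Order.lt_add_one_iff.2 le_rfl
    set c : MulAut (Equiv.Perm (S.X γ)) :=
      MulAut.conj ((φ γ hγα).toEquiv * Equiv.mulLeft (h γ) : Equiv.Perm (S.X γ)) with hc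
    refine ⟨((S.succIso γ α hα).trans c).trans (S.succIso γ α hα).symm, ?_, ?_⟩
    · intro β hβ x
      have hβγ := le_of_lt_of_eq_add_one hα hβ
      rw [← S.f_f hβγ hγα.le, ← S.f_f hβγ hγα.le]
      apply (S.succIso γ α hα).injective
      simp only [MulEquiv.trans_apply, MulEquiv.apply_symm_apply]
      rw [S.succIso_map, S.succIso_map, hc, conj_mul_mulLeft_rightRegular, hφ]
    · intro β hβ e y
      obtain rfl : β = γ := Subtype.ext (Order.add_one_inj.1 (e.symm.trans hα))
      simp [hc]
  · obtain ⟨ψ, hψ⟩ := (S.limit α hα).exists_mulAut (fun i j hij => S.f_injective i.1 j.1 hij)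
      (fun β => φ β.1 β.2) (fun β γ hβγ x => hφ β.1 γ.1 γ.2 hβγ x)
    refine ⟨ψ, fun β hβ x => hψ ⟨β, hβ⟩ x, fun β hβ e => ?_⟩
    exact absurd hα (by rw [e]; exact Order.not_isSuccLimit_add_one _)

open Classical in
/-- The tower of automorphisms of the stages determined by the choices `h`. -/
noncomputable def tower (h : ∀ α, S.X α) : ∀ α, MulAut (S.X α) :=
  WellFoundedLT.fix fun α φ =>
    -- The value `1` is never taken, by `isExtension_tower`.
    if H : ∃ ψ, S.IsExtension h α φ ψ then H.choose else 1

/-- The induction hypothesis supplies the coherence of the earlier automorphisms that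
`exists_isExtension` requires. -/
theorem isExtension_tower (h : ∀ α, S.X α) (α : Set.Iio κ.ord) :
    S.IsExtension h α (fun β _ => S.tower h β) (S.tower h α) := by
  induction α using WellFoundedLT.induction with
  | ind α ih =>
  have H : ∃ ψ, S.IsExtension h α (fun β _ => S.tower h β) ψ := by
    refine S.exists_isExtension h α _ fun β γ hγ hβγ x => ?_
    rcases hβγ.eq_or_lt with rfl | hlt
    · rw [f_self, f_self]
    · exact (ih γ hγ).1 β hlt x
  have : S.tower h α = H.choose := (WellFoundedLT.fix_eq _ α).trans (dif_pos H)
  rw [this]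
  exact H.choose_spec

theorem exists_mulAut (h : ∀ α, S.X α) :
    ∃ b : MulAut G, ∀ α x, b (S.ι α x) = S.ι α (S.tower h α x) := by
  refine S.isLimit.exists_mulAut S.f_injective (S.tower h) fun α β hαβ x => ?_
  rcases hαβ.eq_or_lt with rfl | hlt
  · rw [f_self, f_self]
  · exact (S.isExtension_tower h β).1 α hlt x

/-- The automorphisms at stages `α` and `α + 1` together determine `h α`; stage `α + 1` exists
because `κ.ord` is a limit. -/
theorem tower_injective (h0 : 3 ≤ #G₀) (hκ : ℵ₀ < κ) : Function.Injective S.tower := by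
  intro h h' hh
  funext α
  let β : Set.Iio κ.ord := ⟨α + 1, (isSuccLimit_ord hκ.le).add_one_lt α.2⟩
  have hαβ : α < β := show (α : Ordinal.{u}) < α + 1 from Order.lt_add_one_iff.2 le_rfl
  apply conj_mul_mulLeft_injective (S.three_le_mk h0 α) (S.tower h α)
  refine MulEquiv.ext fun y => ?_
  obtain ⟨y, rfl⟩ := (S.succIso α β rfl).surjective y
  have h1 := (S.isExtension_tower h β).2 α hαβ rfl y
  have h2 := (S.isExtension_tower h' β).2 α hαβ rfl y
  rw [← hh] at h2
  exact h1.symm.trans h2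

theorem exists_embedding_mulAut (h0 : 3 ≤ #G₀) (hκ : ℵ₀ < κ) :
    Nonempty ((∀ α, S.X α) ↪ MulAut G) := by
  choose b hb using S.exists_mulAut
  refine ⟨⟨b, fun h h' hh => S.tower_injective h0 hκ ?_⟩⟩
  funext α
  refine MulEquiv.ext fun x => S.ι_injective α ?_
  rw [← hb, ← hb, hh]

theorem two_power_mk_le_mk_mulAut (S : LimitOfRegularRepresentations κ G₀ G)
    (h0 : 3 ≤ #G₀) (hκ : ℵ₀ < κ) : 2 ^ #G ≤ #(MulAut G) := by
  have hlt : ∀ α : Set.Iio κ.ord, ω + (α : Ordinal.{u}) < κ.ord :=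
    fun α => isPrincipal_add_ord hκ.le (omega0_lt_ord.2 hκ) α.2
  let g : Set.Iio κ.ord → Set.Iio κ.ord := fun α => ⟨ω + α, hlt α⟩
  let g' : Set.Iio κ.ord → Set.Iio κ.ord :=
    fun α => ⟨ω + α + 1, (isSuccLimit_ord hκ.le).add_one_lt (hlt α)⟩
  have hg' : Function.Injective g' := by
    intro α β h
    have : ω + (α : Ordinal.{u}) + 1 = ω + β + 1 := congrArg Subtype.val h
    exact Subtype.ext (by simpa using this)
  have hs : Function.Surjective fun p : Σ α, S.X (g α) => S.ι (g p.1) p.2 := by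
    intro y
    obtain ⟨α, x, rfl⟩ := S.isLimit.exists_rep y
    have hle : α ≤ g α := show (α : Ordinal.{u}) ≤ ω + α from le_add_self
    exact ⟨⟨α, S.f _ _ hle x⟩, S.isLimit.map_eq hle x⟩
  have hstage : ∀ α, Nonempty (Set (S.X (g α)) ≃ S.X (g' α)) := by
    intro α
    have : Infinite (S.X (g α)) :=
      infinite_iff.2 ((aleph0_le_beth _).trans (S.beth_le_mk h0 hκ α (hlt α)))
    refine Cardinal.eq.1 ?_
    rw [mk_set, S.mk_succ (α := g α) (β := g' α) rfl, mk_perm_eq_two_power]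
  let e₁ : Set G ↪ Set (Σ α, S.X (g α)) := ⟨_, hs.preimage_injective⟩
  let e₂ : Set (Σ α, S.X (g α)) ≃ ∀ α, Set (S.X (g α)) := Equiv.piCurry fun α _ => Prop
  let e₃ : (∀ α, Set (S.X (g α))) ≃ ∀ α, S.X (g' α) :=
    Equiv.piCongrRight fun α => (hstage α).some
  -- A section of the restriction to the coordinates in the range of `g'`.
  let e₄ : (∀ α, S.X (g' α)) ↪ ∀ α, S.X α :=
    Function.Embedding.ofSurjective _ (Pi.surjective_comp_injective hg')
  obtain ⟨e₅⟩ := S.exists_embedding_mulAut h0 hκ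
  rw [← mk_set]
  exact mk_le_of_injective
    ((((e₁.trans e₂.toEmbedding).trans e₃.toEmbedding).trans e₄).trans e₅).injective

end LimitOfRegularRepresentations

theorem corollary3p3 (κ : Cardinal.{u}) (hκ : ℵ₀ < κ)
    (G₀ G : Type u) [Group G₀] [Group G] [Countable G₀] (hG₀ : 3 ≤ #G₀)
    (S : LimitOfRegularRepresentations κ G₀ G) :
    #(MulAut G) = ℶ_ (κ.ord + 1) := by
  have hG := S.mk_eq_beth hG₀ hκ
  have : Infinite G := infinite_iff.2 ((aleph0_le_beth κ.ord).trans_eq hG.symm)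
  rw [beth_add_one, ← hG]
  exact le_antisymm mk_mulAut_le_two_power (S.two_power_mk_le_mk_mulAut hG₀ hκ)
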